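/- Let $(\mathcal R,\partial)$ be a commutative differential ring with ring of constants $\mathcal C=\ker\partial$, and let $\mathrm Q:\mathcal R\to\mathcal R$ be a quasi-integration, i.e. a $\mathcal C$-linear map with $\partial\mathrm Q\partial=\partial$ and $\mathrm Q\partial\mathrm Q=\mathrm Q$. Put $\mathcal R_{\mathrm T}:=\ker\mathrm Q$. All tensor products are over $\mathcal C$. **The algebra $\mathcal C_2$.** Let $\widetilde{\mathcal T}:=\bigoplus_{n\ge1}\mathcal R_{\mathrm T}^{\otimes n}$, let $M_2:=\widetilde{\mathcal T}^{\odot 2}=\widetilde{\mathcal T}^{\otimes2}/\operatorname{span}_{\mathcal C}\{f\otimes g-g\otimes f\}$ be its symmetric square, with $f\odot g$ the class of $f\otimes g$, and let $\varepsilon:M_2\to\varepsilon(M_2)$ be an isomorphic copy of $M_2$. For a pure tensor $f=f_1\otimes\dots\otimes f_n$ write $f_i^j:=f_i\otimes\dots\otimes f_j$, which is the empty tensor if $i=j+1$. The shuffle product of pure tensors is $t\mathbin{\sqcup\!\sqcup} s:=t\otimes s$ if $t$ or $s$ is the empty tensor, and otherwise, for $t$ of length $n$ and $s$ of length $m$,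 recursively $t\mathbin{\sqcup\!\sqcup} s:=t_1\otimes(t_2^n\mathbin{\sqcup\!\sqcup} s)+s_1\otimes(t\mathbin{\sqcup\!\sqcup} s_2^m)$. Then $\mathcal C_2:=\mathrm{Sym}(\varepsilon(M_2))/J_2$, where the ideal $J_2$ is generated by the elements $$\varepsilon((f\mathbin{\sqcup\!\sqcup} g)\odot h)-\varepsilon(f\odot(g\mathbin{\sqcup\!\sqcup} h))+\sum_{j=0}^{m-1}\Bigg(\sum_{i=\max(0,1-j)}^{n-1}\varepsilon(f_{i+1}^n\odot g_{j+1}^m)\cdot\varepsilon((f_1^i\mathbin{\sqcup\!\sqcup} g_1^j)\odot h)-\sum_{k=\max(0,1-j)}^{l-1}\varepsilon(f\odot(g_1^j\mathbin{\sqcup\!\sqcup} h_1^k))\cdot\varepsilon(g_{j+1}^m\odot h_{k+1}^l)\Bigg)$$ for all $n,m,l\ge1$ and all pure tensors $f\in\mathcal R_{\mathrm T}^{\otimes n}$, $g\in\mathcal R_{\mathrm T}^{\otimes m}$, $h\in\mathcal R_{\mathrm T}^{\otimes l}$. **Words.** Let $(I,\le)$ be a totally ordered set and $\langle I\rangle^*$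 the set of nonempty words over $I$. The order $\le_{\mathrm{dlex}}$ compares words first by length and then lexicographically. A word is a Lyndon word if it is nonempty and lexicographically smaller than each of its proper nonempty suffixes. The maximal shuffle of two words is the lexicographically greatest of the words obtained by shuffling them (i.e. interleaving them while keeping the order of the letters of each). Let $$S:=\{(V,W)\in(\langle I\rangle^*)^2\mid V\le_{\mathrm{dlex}}W,\ V\text{ is a Lyndon word, and }W\text{ is not the maximal shuffle of some }W_1,W_2\in\langle I\rangle^*\text{ with }W_1<_{\mathrm{dlex}}V\}.$$ **Statement.** Assume that $\mathbb Q\subseteq\mathcal C$ and that $\mathcal R_{\mathrm T}$ is generated as a $\mathcal C$-module by $\{a_i\mid i\in I\}\subseteq\mathcal R_{\mathrm T}$. For $V=v_1\cdots v_p$ and $W=w_1\cdots w_q$ in $\langle I\rangle^*$ let $c(V,W)\in\mathcal C_2$ be the class of $\varepsilon((a_{v_1}\otimes\dots\otimes a_{v_p})\odot(a_{w_1}\otimes\dots\otimes a_{w_q}))$. Then $\mathcal C_2$ is generated as a $\mathcal C$-algebra by the set $\{c(V,W)\mid(V,W)\in S\}$. -/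

import Mathlib

open scoped TensorProduct

noncomputable section

namespace FreeIDR

/-! ### Differential rings and quasi-integrations -/

/-- The subring of constants `{f | ∂ f = 0}` of a commutative differential ring. -/
def constants (R : Type*) [CommRing R] [Differential R] : Subring R where
  carrier := {f | Differential.deriv f = 0}
  mul_mem' := by
    intro a b ha hb
    simp only [Set.mem_ofPred_eq] at ha hb ⊢
    simp [ha, hb]
  one_mem' := by simp
  add_mem' := by
    intro a b ha hb
    simp only [Set.mem_ofPred_eq] at ha hb ⊢
    simp [ha, hb]
  zero_mem' := by simp
  neg_mem' := by
    intro a ha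
    simp only [Set.mem_ofPred_eq] at ha ⊢
    simp [ha]

/-- A quasi-integration on a differential ring: an endomorphism `Q` of the module `R` over the
constants with `∂ Q ∂ = ∂` and `Q ∂ Q = Q`. -/
def IsQuasiIntegration {R : Type*} [CommRing R] [Differential R]
    (Q : R →ₗ[constants R] R) : Prop :=
  (∀ f : R, Differential.deriv (Q (Differential.deriv f)) = Differential.deriv f) ∧
    ∀ f : R, Q (Differential.deriv (Q f)) = Q f

/-- The module `R_T = ker Q` of non-integrable elements (a complement of `∂ R`). -/
abbrev nonIntegrable {R : Type*} [CommRing R] [Differential R]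
    (Q : R →ₗ[constants R] R) : Submodule (constants R) R :=
  LinearMap.ker Q

/-! ### Tensors and shuffles -/

section Construction

variable (C : Type*) [CommRing C] {M : Type*} [AddCommGroup M] [Module C M]

/-- The pure tensor `f₁ ⊗ ⋯ ⊗ fₙ` in the tensor algebra of `M`, given by the list of its
factors; the empty list gives the empty tensor `1`. -/
def pureTensor (f : List M) : TensorAlgebra C M :=
  (f.map (TensorAlgebra.ι C)).prod

/-- The shuffle product of the two pure tensors with the given lists of factors. -/
def shuffle : List M → List M → TensorAlgebra C M
  | [], s => pureTensor C s
  | t, [] => pureTensor C t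
  | x :: t, y :: s =>
      TensorAlgebra.ι C x * shuffle t (y :: s) + TensorAlgebra.ι C y * shuffle (x :: t) s
  termination_by t s => t.length + s.length

variable (M)

/-- The submodule `⨁_{n ≥ 1} M^{⊗ n}` of the tensor algebra, as the kernel of the projection
onto the component of degree `0`. -/
def positivePart : Submodule C (TensorAlgebra C M) :=
  LinearMap.ker (TensorAlgebra.algebraMapInv (R := C) (M := M)).toLinearMap

variable {M}

theorem pureTensor_mem_positivePart {f : List M} (hf : f ≠ []) :
    pureTensor C f ∈ positivePart C M := by
  cases f with
  | nil => exact absurd rfl hf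
  | cons x t => simp [pureTensor, positivePart, TensorAlgebra.algebraMapInv]

theorem shuffle_mem_positivePart {f g : List M} (h : f ≠ [] ∨ g ≠ []) :
    shuffle C f g ∈ positivePart C M := by
  match f, g, h with
  | [], s, h =>
    rw [shuffle]
    exact pureTensor_mem_positivePart C (by simpa using h)
  | x :: t, [], h =>
    rw [shuffle]
    · exact pureTensor_mem_positivePart C (by simp)
    · simp
  | x :: t, y :: s, h =>
    rw [shuffle]
    simp [positivePart, TensorAlgebra.algebraMapInv]

variable (M)

/-- The projection of the tensor algebra onto `⨁_{n ≥ 1} M^{⊗ n}` that removes the component of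
degree `0`. -/
def positiveProj : TensorAlgebra C M →ₗ[C] positivePart C M :=
  LinearMap.codRestrict (positivePart C M)
    (LinearMap.id - (Algebra.linearMap C (TensorAlgebra C M)).comp
      (TensorAlgebra.algebraMapInv (R := C) (M := M)).toLinearMap)
    (fun x => by
      change TensorAlgebra.algebraMapInv
        (x - algebraMap C (TensorAlgebra C M) (TensorAlgebra.algebraMapInv x)) = (0 : C)
      rw [map_sub, TensorAlgebra.algebraMap_leftInverse M _, sub_self])

variable {M} in
theorem positiveProj_of_mem {x : TensorAlgebra C M} (hx : x ∈ positivePart C M) :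
    positiveProj C M x = ⟨x, hx⟩ := by
  have h : TensorAlgebra.algebraMapInv (R := C) (M := M) x = 0 := hx
  apply Subtype.ext
  change x - algebraMap C (TensorAlgebra C M) (TensorAlgebra.algebraMapInv x) = x
  rw [h, map_zero, sub_zero]

/-! ### The symmetric square of a module -/

/-- The submodule of `X ⊗ X` spanned by the elements `f ⊗ g - g ⊗ f`. -/
def symmRelations (X : Type*) [AddCommGroup X] [Module C X] : Submodule C (X ⊗[C] X) :=
  Submodule.span C {z | ∃ f g : X, z = f ⊗ₜ[C] g - g ⊗ₜ[C] f}

/-- The symmetric product of a module with itself. -/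
abbrev SymmSquare (X : Type*) [AddCommGroup X] [Module C X] : Type _ :=
  (X ⊗[C] X) ⧸ symmRelations C X

/-- The symmetric product `f ⊙ g` of two elements of a module. -/
def symmProd {X : Type*} [AddCommGroup X] [Module C X] (f g : X) : SymmSquare C X :=
  (symmRelations C X).mkQ (f ⊗ₜ[C] g)

/-! ### The algebra of evaluation constants -/

/-- The module `M₂`, the symmetric product of `⨁_{n ≥ 1} M^{⊗ n}` with itself. -/
abbrev ModuleM2 : Type _ := SymmSquare C (positivePart C M)

variable {M}

/-- The generator `ε(f ⊙ g)` of the symmetric algebra on `M₂`, for tensors `f` and `g` without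
component of degree `0` (such a component is dropped). -/
def eps (f g : TensorAlgebra C M) : SymmetricAlgebra C (ModuleM2 C M) :=
  SymmetricAlgebra.ι C (ModuleM2 C M)
    (symmProd C (positiveProj C M f) (positiveProj C M g))

/-- The relation attached to the pure tensors with lists of factors `f`, `g`, `h`.
Here `f.take i` is `f₁ ⊗ ⋯ ⊗ fᵢ` and `f.drop i` is `fᵢ₊₁ ⊗ ⋯ ⊗ fₙ`; the truncated subtraction
`1 - j` in `ℕ` is `max(0, 1 - j)`. -/
def constRel (f g h : List M) : SymmetricAlgebra C (ModuleM2 C M) :=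
  eps C (shuffle C f g) (pureTensor C h) - eps C (pureTensor C f) (shuffle C g h) +
    ∑ j ∈ Finset.range g.length,
      ((∑ i ∈ Finset.Ico (1 - j) f.length,
          eps C (pureTensor C (f.drop i)) (pureTensor C (g.drop j)) *
            eps C (shuffle C (f.take i) (g.take j)) (pureTensor C h)) -
        ∑ k ∈ Finset.Ico (1 - j) h.length,
          eps C (pureTensor C f) (shuffle C (g.take j) (h.take k)) *
            eps C (pureTensor C (g.drop j)) (pureTensor C (h.drop k)))

variable (M)

/-- The ideal `J₂` generated by the relations of all pure tensors of length at least `1`. -/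
def constIdeal : Ideal (SymmetricAlgebra C (ModuleM2 C M)) :=
  Ideal.span {r | ∃ f g h : List M, f ≠ [] ∧ g ≠ [] ∧ h ≠ [] ∧ r = constRel C f g h}

/-- The algebra `C₂ = Sym(ε(M₂)) / J₂` of evaluation constants. -/
abbrev EvalConstants : Type _ :=
  SymmetricAlgebra C (ModuleM2 C M) ⧸ constIdeal C M

variable {M}

/-- The class in `C₂` of `c(V,W) = ε((a_{v₁} ⊗ ⋯) ⊙ (a_{w₁} ⊗ ⋯))`. -/
def wordConst {I : Type*} (a : I → M) (V W : List I) : EvalConstants C M :=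
  Ideal.Quotient.mk (constIdeal C M)
    (eps C (pureTensor C (V.map a)) (pureTensor C (W.map a)))

end Construction

/-! ### Words -/

section Words

variable {I : Type*}

/-- The set `sh(V,W)` of shuffles of two words. -/
def wordShuffles : List I → List I → Set (List I)
  | [], W => {W}
  | V, [] => {V}
  | v :: V, w :: W =>
      (fun U => v :: U) '' wordShuffles V (w :: W) ∪
        (fun U => w :: U) '' wordShuffles (v :: V) W
  termination_by V W => V.length + W.length

variable [LinearOrder I]

/-- The strict degree-lexicographic order on words. -/
def DlexLT (V W : List I) : Prop := List.Shortlex (· < ·) V W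

/-- The degree-lexicographic order on words. -/
def DlexLE (V W : List I) : Prop := DlexLT V W ∨ V = W

/-- A Lyndon word is a nonempty word all of whose proper nonempty suffixes are
lexicographically greater than the word itself. -/
def IsLyndon (V : List I) : Prop :=
  V ≠ [] ∧ ∀ U : List I, U <:+ V → U ≠ [] → U ≠ V → V < U

/-- `W` is the lexicographically maximal shuffle of `W₁` and `W₂`. -/
def IsMaxShuffle (W W₁ W₂ : List I) : Prop := IsGreatest (wordShuffles W₁ W₂) W

variable (I) in
/-- The set `S` of pairs of nonempty words. -/
def generatorPairs : Set (List I × List I) :=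
  {p | p.1 ≠ [] ∧ p.2 ≠ [] ∧ DlexLE p.1 p.2 ∧ IsLyndon p.1 ∧
    ¬ ∃ W₁ W₂ : List I, W₁ ≠ [] ∧ W₂ ≠ [] ∧ DlexLT W₁ p.1 ∧ IsMaxShuffle p.2 W₁ W₂}

end Words

end FreeIDR

end

noncomputable section

namespace FreeIDR

/-! ### Shuffles of words -/

section WordLemmas

variable {I : Type*}

/-! The quadratic terms of the relations involve only constants of smaller total length. Modulo the
subalgebra `A` generated by the given constants, and once all smaller total lengths are known to lie
in `A`, what remains is `c(F ⧢ G, H) ≡ c(F, G ⧢ H)` (`IsShufflePairing.shuffle_sub_mem`). Thus a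
shuffle factor can be moved from one argument to the other.

If a word `X` is the maximal shuffle of `X₁` and `X₂`, then `X₁ ⧢ X₂` is a positive multiple of `X`
plus smaller words with the same letters. The multiplicity is invertible over `ℚ`, so `c(X, H)`
reduces to the smaller words and to `c(X₁, X₂ ⧢ H)`. For a pair `(V, W)` this helps in two cases. If
`V` is not Lyndon, it is the maximal shuffle of two shorter words
(`exists_isMaxShuffle_of_not_isLyndon`). If `W` is the maximal shuffle of some `W₁`, `W₂` with `W₁`
below `V`, the first argument drops to `W₁`. By symmetry `V` may also be assumed to be at most `W`,
and the pairs left over form `S`. The induction runs on total length, then on `V`, then on `W`. -/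

theorem wordShuffles_nil_left (W : List I) : wordShuffles [] W = {W} := by
  rw [wordShuffles]

theorem wordShuffles_nil_right (V : List I) : wordShuffles V [] = {V} := by
  cases V with
  | nil => rw [wordShuffles]
  | cons v V => rw [wordShuffles]; simp

theorem mem_wordShuffles_cons_cons {v w : I} {V W Z : List I} :
    Z ∈ wordShuffles (v :: V) (w :: W) ↔
      (∃ U ∈ wordShuffles V (w :: W), v :: U = Z) ∨
        ∃ U ∈ wordShuffles (v :: V) W, w :: U = Z := by
  rw [wordShuffles]
  rfl

theorem cons_mem_wordShuffles_left {v : I} {V W Z : List I} (h : Z ∈ wordShuffles V W) :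
    v :: Z ∈ wordShuffles (v :: V) W := by
  cases W with
  | nil =>
    rw [wordShuffles_nil_right] at h ⊢
    rw [Set.mem_singleton_iff.1 h]
    rfl
  | cons w W => exact mem_wordShuffles_cons_cons.2 (Or.inl ⟨Z, h, rfl⟩)

theorem cons_mem_wordShuffles_right {w : I} {V W Z : List I} (h : Z ∈ wordShuffles V W) :
    w :: Z ∈ wordShuffles V (w :: W) := by
  cases V with
  | nil =>
    rw [wordShuffles_nil_left] at h ⊢
    rw [Set.mem_singleton_iff.1 h]
    rfl
  | cons v V => exact mem_wordShuffles_cons_cons.2 (Or.inr ⟨Z, h, rfl⟩)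

theorem append_mem_wordShuffles (V W : List I) : V ++ W ∈ wordShuffles V W := by
  induction V with
  | nil => simp [wordShuffles_nil_left]
  | cons v V ih => exact cons_mem_wordShuffles_left ih

theorem perm_of_mem_wordShuffles {V W Z : List I} (h : Z ∈ wordShuffles V W) :
    Z.Perm (V ++ W) := by
  match V, W, h with
  | [], W, h =>
    rw [wordShuffles_nil_left] at h
    rw [Set.mem_singleton_iff.1 h]
    exact .refl _
  | v :: V, [], h =>
    rw [wordShuffles_nil_right] at h
    rw [Set.mem_singleton_iff.1 h, List.append_nil]
  | v :: V, w :: W, h =>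
    rcases mem_wordShuffles_cons_cons.1 h with ⟨U, hU, rfl⟩ | ⟨U, hU, rfl⟩
    · exact (perm_of_mem_wordShuffles hU).cons v
    · exact ((perm_of_mem_wordShuffles hU).cons w).trans List.perm_middle.symm
  termination_by V.length + W.length

theorem length_of_mem_wordShuffles {V W Z : List I} (h : Z ∈ wordShuffles V W) :
    Z.length = V.length + W.length := by
  rw [(perm_of_mem_wordShuffles h).length_eq, List.length_append]

/-! ### Maximal shuffles and Lyndon words -/

variable [LinearOrder I]

theorem cons_le_cons_iff_lt_or {x y : I} {X Y : List I} :
    x :: X ≤ y :: Y ↔ x < y ∨ x = y ∧ X ≤ Y := by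
  rw [le_iff_lt_or_eq, le_iff_lt_or_eq, List.cons_lt_cons_iff, List.cons.injEq]
  tauto

/-- Exchange argument: handing a prefix `B` over from the larger word to the smaller one does not
decrease the maximal shuffle. Read `Z` letter by letter and imitate it until a strictly larger
letter becomes available. -/
theorem exists_le_mem_wordShuffles {B X Y Z : List I} (hXY : Y ≤ X)
    (hZ : Z ∈ wordShuffles (B ++ X) Y) : ∃ Z' ∈ wordShuffles X (B ++ Y), Z ≤ Z' := by
  match B, Y, hXY, hZ with
  | B, [], hXY, hZ =>
    rw [wordShuffles_nil_right] at hZ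
    rw [Set.mem_singleton_iff.1 hZ]
    refine ⟨B ++ X, ?_, le_rfl⟩
    clear hZ hXY
    induction B with
    | nil => exact (wordShuffles_nil_right X).symm ▸ rfl
    | cons b B ih => exact cons_mem_wordShuffles_right ih
  | [], y :: Y, hXY, hZ => exact ⟨Z, hZ, le_rfl⟩
  | b :: B, y :: Y, hXY, hZ =>
    rcases mem_wordShuffles_cons_cons.1 hZ with ⟨U, hU, rfl⟩ | ⟨U, hU, rfl⟩
    · obtain ⟨Z', hZ', hle⟩ := exists_le_mem_wordShuffles hXY hU
      exact ⟨b :: Z', cons_mem_wordShuffles_right hZ', List.cons_le_cons b hle⟩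
    · match X, hXY, hU with
      | [], hXY, hU => exact absurd hXY (by simp)
      | x :: X, hXY, hU =>
        rcases cons_le_cons_iff_lt_or.1 hXY with hlt | ⟨rfl, hle⟩
        · exact ⟨x :: (X ++ (b :: B ++ y :: Y)),
            cons_mem_wordShuffles_left (append_mem_wordShuffles _ _),
            (cons_le_cons_iff_lt_or.2 (Or.inl hlt))⟩
        -- The common letter `y` is taken from `X` instead of `Y`, so the second word lags by one
        -- more letter and `B` grows to `B ++ [y]`. `Y` is counted twice in the termination measure
        -- to offset this.
        · have hU' : U ∈ wordShuffles ((b :: B ++ [y]) ++ X) Y := by simpa using hU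
          obtain ⟨Z', hZ', hle'⟩ := exists_le_mem_wordShuffles hle hU'
          refine ⟨y :: Z', cons_mem_wordShuffles_left ?_, List.cons_le_cons y hle'⟩
          simpa using hZ'
  termination_by B.length + Y.length + Y.length

/-- A shuffle that starts with a letter of `U` gains at most a tie with the head of `P`. In a tie
the exchange lemma with the one-letter prefix `[u]` gives a shuffle at least as large that starts in
`P`. -/
theorem le_append_of_mem_wordShuffles {P U Z : List I}
    (hP : ∀ T : List I, T <:+ P → T ≠ [] → U ≤ T) (hZ : Z ∈ wordShuffles P U) :
    Z ≤ P ++ U := by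
  induction P generalizing Z with
  | nil =>
    rw [wordShuffles_nil_left] at hZ
    exact (Set.mem_singleton_iff.1 hZ).le
  | cons x P ih =>
    have hP' : ∀ T : List I, T <:+ P → T ≠ [] → U ≤ T := fun T hT =>
      hP T (hT.trans (List.suffix_cons x P))
    cases U with
    | nil =>
      rw [wordShuffles_nil_right] at hZ
      rw [Set.mem_singleton_iff.1 hZ, List.append_nil]
    | cons u U =>
      rcases mem_wordShuffles_cons_cons.1 hZ with ⟨Z', hZ', rfl⟩ | ⟨Z', hZ', rfl⟩
      · exact List.cons_le_cons x (ih hP' hZ')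
      · rcases cons_le_cons_iff_lt_or.1 (hP (x :: P) List.suffix_rfl (by simp)) with
          hlt | ⟨rfl, hle⟩
        · exact cons_le_cons_iff_lt_or.2 (Or.inl hlt)
        · obtain ⟨Z'', hZ'', hle'⟩ := exists_le_mem_wordShuffles (B := [u]) hle hZ'
          exact List.cons_le_cons u (hle'.trans (ih hP' hZ''))

/-- Split `V = P ++ U` with `U` its smallest nonempty suffix. `P` is nonempty because `V` is not
Lyndon, and concatenation is then the maximal shuffle. -/
theorem exists_isMaxShuffle_of_not_isLyndon {V : List I} (hV : V ≠ []) (hL : ¬ IsLyndon V) :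
    ∃ P U : List I, P ≠ [] ∧ U ≠ [] ∧ IsMaxShuffle V P U := by
  have hfin : {U : List I | U <:+ V ∧ U ≠ []}.Finite :=
    (List.finite_toSet V.tails).subset fun U hU => (List.mem_tails U V).2 hU.1
  obtain ⟨U, ⟨hUV, hU⟩, hmin⟩ :=
    hfin.exists_minimal ⟨V, List.suffix_rfl, hV⟩
  have hmin' : ∀ T : List I, T <:+ V → T ≠ [] → U ≤ T := fun T hT hT0 =>
    (le_total U T).elim id fun h => hmin ⟨hT, hT0⟩ h
  obtain ⟨P, rfl⟩ := hUV
  have hP : P ≠ [] := by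
    rintro rfl
    refine hL ⟨hV, fun T hT hT0 hne => lt_of_le_of_ne (hmin' T hT hT0) (Ne.symm hne)⟩
  refine ⟨P, U, hP, hU, append_mem_wordShuffles P U, fun Z hZ =>
    le_append_of_mem_wordShuffles (fun T hT hT0 => ?_) hZ⟩
  by_contra! hlt
  have h1 : U ≤ T ++ U := hmin' _ (by
    obtain ⟨S, rfl⟩ := hT
    exact ⟨S, by simp⟩) (by simp [hT0])
  -- A word squeezed between `T` and `T ++ X` has `T` as a prefix. The rest `U'` of `U` is again a
  -- suffix of `V`, so minimality forces `U' = U`, which is impossible by length.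
  have key : ∀ T U X : List I, T < U → U ≤ T ++ X → ∃ U', U = T ++ U' ∧ U' ≠ [] ∧ U' ≤ X := by
    intro T
    induction T with
    | nil =>
      intro U X hlt hle
      exact ⟨U, rfl, by rintro rfl; exact lt_irrefl _ hlt, hle⟩
    | cons t T ih =>
      intro U X hlt hle
      cases U with
      | nil => exact absurd hlt (by simp)
      | cons u U =>
        rw [List.cons_append] at hle
        rcases List.cons_lt_cons_iff.1 hlt with h | ⟨rfl, h⟩
        · rcases cons_le_cons_iff_lt_or.1 hle with h' | ⟨rfl, h'⟩
          · exact absurd h h'.asymm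
          · exact absurd h (lt_irrefl _)
        · rcases cons_le_cons_iff_lt_or.1 hle with h' | ⟨_, h'⟩
          · exact absurd h' (lt_irrefl _)
          · obtain ⟨U', rfl, hU'⟩ := ih U X h h'
            exact ⟨U', rfl, hU'⟩
  obtain ⟨U', hUU', hU'0, hle⟩ := key T U U hlt h1
  have h2 : U ≤ U' := hmin' U' ⟨P ++ T, by rw [List.append_assoc, ← hUU']⟩ hU'0
  have h3 : U.length = U'.length := by rw [le_antisymm h2 hle]
  rw [hUU', List.length_append] at h3
  exact hT0 (List.length_eq_zero_iff.1 (by omega))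

/-! ### The degree-lexicographic order -/

theorem DlexLT.of_lt {V W : List I} (hlen : V.length = W.length) (h : V < W) : DlexLT V W :=
  List.Shortlex.of_lex hlen h

theorem dlexLT_of_not_dlexLE {V W : List I} (h : ¬ DlexLE V W) : DlexLT W V := by
  by_contra h'
  exact h (Or.inr (Std.Trichotomous.trichotomous (r := List.Shortlex (· < ·)) V W
    (fun h0 => h (Or.inl h0)) h'))

instance : IsStrictOrder (List I) DlexLT where
  irrefl V h := by
    rcases List.shortlex_def.1 h with h | ⟨_, h⟩
    · exact lt_irrefl _ h
    · exact lt_irrefl V h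
  trans U V W h h' := by
    rcases List.shortlex_def.1 h with h | ⟨e, h⟩ <;>
      rcases List.shortlex_def.1 h' with h' | ⟨e', h'⟩
    · exact List.Shortlex.of_length_lt (h.trans h')
    · exact List.Shortlex.of_length_lt (e' ▸ h)
    · exact List.Shortlex.of_length_lt (e ▸ h')
    · exact List.Shortlex.of_lex (e.trans e') (lt_trans (a := U) h h')

/-- The words that are subwords of a rearrangement of `L` are well-founded under `DlexLT`. -/
theorem wellFoundedOn_dlexLT (L : List I) :
    {V : List I | ∃ W, (V ++ W).Perm L}.WellFoundedOn DlexLT := by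
  refine Set.Finite.wellFoundedOn ?_
  refine (List.finite_toSet (L.permutations.flatMap List.sublists)).subset ?_
  rintro V ⟨W, h⟩
  exact List.mem_flatMap.2 ⟨V ++ W, List.mem_permutations.2 h,
    List.mem_sublists.2 (List.sublist_append_left V W)⟩

end WordLemmas

/-! ### Reduction of word pairs for an abstract shuffle pairing -/

section ShufflePairing

variable (C : Type*) [CommRing C] {M : Type*} [AddCommGroup M] [Module C M]
variable {I : Type*} (a : I → M)

/-- The pure tensor of the letters of a word. -/
def wordTensor (V : List I) : TensorAlgebra C M := pureTensor C (V.map a)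

/-- The shuffle product of the pure tensors of two words. -/
def wordShuffle (V W : List I) : TensorAlgebra C M := shuffle C (V.map a) (W.map a)

/-- The shuffle of two words is the sum of a list of words that enumerates their shuffles. -/
theorem exists_wordShuffle_eq_sum (V W : List I) :
    ∃ L : List (List I), (∀ Z, Z ∈ L ↔ Z ∈ wordShuffles V W) ∧
      wordShuffle C a V W = (L.map (wordTensor C a)).sum := by
  match V, W with
  | [], W =>
    refine ⟨[W], fun Z => by simp [wordShuffles_nil_left], ?_⟩
    simp [wordShuffle, shuffle, wordTensor]
  | v :: V, [] =>
    refine ⟨[v :: V], fun Z => by simp [wordShuffles_nil_right], ?_⟩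
    simp [wordShuffle, shuffle, wordTensor]
  | v :: V, w :: W =>
    obtain ⟨L₁, hL₁, h₁⟩ := exists_wordShuffle_eq_sum V (w :: W)
    obtain ⟨L₂, hL₂, h₂⟩ := exists_wordShuffle_eq_sum (v :: V) W
    refine ⟨L₁.map (List.cons v) ++ L₂.map (List.cons w), fun Z => ?_, ?_⟩
    · simp [mem_wordShuffles_cons_cons, hL₁, hL₂]
    · have hcons : ∀ (u : I) (L : List (List I)),
          ((L.map (List.cons u)).map (wordTensor C a)).sum =
            TensorAlgebra.ι C (a u) * (L.map (wordTensor C a)).sum := by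
        intro u L
        rw [← List.sum_map_mul_left, List.map_map]
        rfl
      rw [List.map_append, List.sum_append, hcons, hcons, ← h₁, ← h₂]
      simp only [wordShuffle, List.map_cons]
      rw [shuffle]
  termination_by V.length + W.length

/-- Modulo `A` the sum is `f i` times its multiplicity in `L`, a positive integer and hence
invertible. This is where `ℚ` in the constants enters. -/
theorem mem_of_sum_map_mem [Algebra ℚ C] {N ι : Type*} [AddCommGroup N] [Module C N]
    (A : Submodule C N) (f : ι → N) {L : List ι} {i : ι} (hi : i ∈ L)
    (hne : ∀ j ∈ L, j ≠ i → f j ∈ A) (hsum : (L.map f).sum ∈ A) : f i ∈ A := by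
  classical
  have key : ∀ L : List ι, (∀ j ∈ L, j ≠ i → f j ∈ A) →
      (L.map f).sum - L.count i • f i ∈ A := by
    intro L
    induction L with
    | nil => intro _; simp
    | cons j L ih =>
      intro h
      have h' := ih fun k hk => h k (List.mem_cons_of_mem j hk)
      by_cases hj : j = i
      · subst hj
        rw [List.map_cons, List.sum_cons, List.count_cons_self, succ_nsmul']
        simpa using h'
      · rw [List.map_cons, List.sum_cons, List.count_cons_of_ne hj, add_sub_assoc]
        exact A.add_mem (h j List.mem_cons_self hj) h'
  have hcount : L.count i • f i ∈ A := by
    have := A.sub_mem hsum (key L hne)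
    rwa [sub_sub_cancel] at this
  have hpos : (L.count i : ℚ) ≠ 0 :=
    Nat.cast_ne_zero.2 (List.count_pos_iff.2 hi).ne'
  have h := A.smul_mem (algebraMap ℚ C (L.count i : ℚ)⁻¹) hcount
  rwa [← Nat.cast_smul_eq_nsmul C, smul_smul, ← map_natCast (algebraMap ℚ C), ← map_mul,
    inv_mul_cancel₀ hpos, map_one, one_smul] at h

variable {C} {E : Type*} [CommRing E] [Algebra C E]
  (B : TensorAlgebra C M →ₗ[C] TensorAlgebra C M →ₗ[C] E)

/-- A bilinear pairing on the tensor algebra that is symmetric and satisfies the quadratic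
relations of the evaluation constants. -/
structure IsShufflePairing : Prop where
  comm : ∀ f g, B f g = B g f
  rel : ∀ f g h : List M, f ≠ [] → g ≠ [] → h ≠ [] →
    B (shuffle C f g) (pureTensor C h) - B (pureTensor C f) (shuffle C g h) +
      ∑ j ∈ Finset.range g.length,
        ((∑ i ∈ Finset.Ico (1 - j) f.length,
            B (pureTensor C (f.drop i)) (pureTensor C (g.drop j)) *
              B (shuffle C (f.take i) (g.take j)) (pureTensor C h)) -
          ∑ k ∈ Finset.Ico (1 - j) h.length,
            B (pureTensor C f) (shuffle C (g.take j) (h.take k)) *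
              B (pureTensor C (g.drop j)) (pureTensor C (h.drop k))) = 0

/-- The value of a pairing at the pure tensors of two words. -/
def wordPairing (V W : List I) : E := B (wordTensor C a V) (wordTensor C a W)

theorem pairing_sum_left (L : List (List I)) (H : List I) :
    B (L.map (wordTensor C a)).sum (wordTensor C a H) =
      (L.map fun Z => wordPairing a B Z H).sum := by
  induction L with
  | nil => exact LinearMap.map_zero₂ B _
  | cons Z L ih =>
    rw [List.map_cons, List.map_cons, List.sum_cons, List.sum_cons, LinearMap.map_add₂, ih,
      wordPairing]

theorem pairing_wordShuffle_mem (A : Submodule C E) {V W H : List I}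
    (h : ∀ Z ∈ wordShuffles V W, wordPairing a B Z H ∈ A) :
    B (wordShuffle C a V W) (wordTensor C a H) ∈ A := by
  obtain ⟨L, hL, hsum⟩ := exists_wordShuffle_eq_sum C a V W
  rw [hsum, pairing_sum_left]
  refine A.toAddSubmonoid.list_sum_mem fun x hx => ?_
  obtain ⟨Z, hZ, rfl⟩ := List.mem_map.1 hx
  exact h Z ((hL Z).1 hZ)

theorem wordPairing_mem_of_isMaxShuffle [Algebra ℚ C] [LinearOrder I]
    (A : Submodule C E) {V P U H : List I} (hV : IsMaxShuffle V P U)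
    (hshuffle : B (wordShuffle C a P U) (wordTensor C a H) ∈ A)
    (hlt : ∀ Z : List I, Z.Perm V → Z < V → wordPairing a B Z H ∈ A) :
    wordPairing a B V H ∈ A := by
  obtain ⟨L, hL, hsum⟩ := exists_wordShuffle_eq_sum C a P U
  rw [hsum, pairing_sum_left] at hshuffle
  refine mem_of_sum_map_mem C A (fun Z => wordPairing a B Z H) ((hL V).2 hV.1)
    (fun Z hZ hne => ?_) hshuffle
  have hZ' := (hL Z).1 hZ
  exact hlt Z ((perm_of_mem_wordShuffles hZ').trans (perm_of_mem_wordShuffles hV.1).symm)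
    (lt_of_le_of_ne (hV.2 hZ') hne)

namespace IsShufflePairing

variable {a B}

theorem wordPairing_comm (hB : IsShufflePairing B) (V W : List I) :
    wordPairing a B V W = wordPairing a B W V :=
  hB.comm _ _

/-- In top degree the pairing is associative with respect to the shuffle product. -/
theorem shuffle_sub_mem (hB : IsShufflePairing B) (A : Subalgebra C E) {F G H : List I}
    (hF : F ≠ []) (hG : G ≠ []) (hH : H ≠ [])
    (hA : ∀ V W : List I, V ≠ [] → W ≠ [] →
      V.length + W.length < F.length + G.length + H.length → wordPairing a B V W ∈ A) :
    B (wordShuffle C a F G) (wordTensor C a H) -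
      B (wordTensor C a F) (wordShuffle C a G H) ∈ A := by
  have hFl := List.length_pos_iff.2 hF
  have hGl := List.length_pos_iff.2 hG
  have hHl := List.length_pos_iff.2 hH
  have hrel := hB.rel (F.map a) (G.map a) (H.map a)
    (by simpa using hF) (by simpa using hG) (by simpa using hH)
  have hsh : ∀ V W U : List I, U ≠ [] → 0 < V.length + W.length →
      V.length + W.length + U.length < F.length + G.length + H.length →
      B (wordShuffle C a V W) (wordTensor C a U) ∈ A := by
    intro V W U hU hpos hlt
    refine pairing_wordShuffle_mem a B (Subalgebra.toSubmodule A) fun Z hZ => ?_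
    have hZl := length_of_mem_wordShuffles hZ
    exact hA Z U (List.length_pos_iff.1 (by omega)) hU (by omega)
  have e : B (wordShuffle C a F G) (wordTensor C a H) -
      B (wordTensor C a F) (wordShuffle C a G H) = _ :=
    eq_neg_of_add_eq_zero_left hrel
  rw [e]
  refine A.neg_mem ?_
  simp only [← List.map_drop, ← List.map_take, List.length_map]
  -- The lower bound `1 - j` gives `i + j ≥ 1` and `j + k ≥ 1`: the shuffled prefixes are nonempty
  -- and the suffix pairs are shorter. The strict upper bounds keep the suffixes nonempty and the
  -- other factors shorter.
  refine A.sum_mem fun j hj => A.sub_mem (A.sum_mem fun i hi => ?_) (A.sum_mem fun k hk => ?_)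
  · rw [Finset.mem_range] at hj
    rw [Finset.mem_Ico] at hi
    refine A.mul_mem (hA (F.drop i) (G.drop j) ?_ ?_ ?_)
      (hsh (F.take i) (G.take j) H hH ?_ ?_)
    · exact List.length_pos_iff.1 (by simp; omega)
    · exact List.length_pos_iff.1 (by simp; omega)
    · simp only [List.length_drop]; omega
    · simp only [List.length_take]; omega
    · simp only [List.length_take]; omega
  · rw [Finset.mem_range] at hj
    rw [Finset.mem_Ico] at hk
    have h := hsh (G.take j) (H.take k) F hF
      (by simp only [List.length_take]; omega) (by simp only [List.length_take]; omega)
    rw [hB.comm] at h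
    refine A.mul_mem h (hA (G.drop j) (H.drop k) ?_ ?_ ?_)
    · exact List.length_pos_iff.1 (by simp; omega)
    · exact List.length_pos_iff.1 (by simp; omega)
    · simp only [List.length_drop]; omega

theorem wordPairing_mem_of_generatorPairs [LinearOrder I] [Algebra ℚ C]
    (hB : IsShufflePairing B) (A : Subalgebra C E)
    (hA : ∀ p ∈ generatorPairs I, wordPairing a B p.1 p.2 ∈ A) (V W : List I)
    (hV : V ≠ []) (hW : W ≠ []) : wordPairing a B V W ∈ A := by
  induction hN : V.length + W.length using Nat.strong_induction_on generalizing V W with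
  | _ N ihN =>
  -- In total length `N` the factor `G` may change sides, since the error lies in `A` by `ihN`.
  have hassoc : ∀ F G H : List I, F ≠ [] → G ≠ [] → H ≠ [] →
      F.length + G.length + H.length = N →
      (∀ Z ∈ wordShuffles G H, wordPairing a B F Z ∈ A) →
      B (wordShuffle C a F G) (wordTensor C a H) ∈ A := by
    intro F G H hF hG hH hlen hZ
    have h1 := hB.shuffle_sub_mem A hF hG hH
      fun V W hV hW hlt => ihN _ (hlen ▸ hlt) V W hV hW rfl
    have h2 : B (wordShuffle C a G H) (wordTensor C a F) ∈ A :=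
      pairing_wordShuffle_mem a B (Subalgebra.toSubmodule A)
        fun Z hZ' => hB.wordPairing_comm F Z ▸ hZ Z hZ'
    rw [hB.comm] at h2
    have h3 := A.add_mem h1 h2
    rwa [sub_add_cancel] at h3
  -- All reductions preserve the multiset `L` of letters of the pair. Fixing it leaves finitely many
  -- words, so the order is well-founded even if `I` is not well-ordered.
  obtain ⟨L, hL⟩ : ∃ L, (V ++ W).Perm L := ⟨_, .refl _⟩
  have hLN : L.length = N := by rw [← hL.length_eq, List.length_append, hN]
  clear hN
  refine (wellFoundedOn_dlexLT L).induction (P := fun V => ∀ W, V ≠ [] → W ≠ [] →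
    (V ++ W).Perm L → wordPairing a B V W ∈ A) ⟨W, hL⟩ ?_ W hV hW hL
  clear! V W
  intro V _ ihV W hV hW hL
  replace ihV : ∀ V', DlexLT V' V → ∀ W', V' ≠ [] → W' ≠ [] → (V' ++ W').Perm L →
      wordPairing a B V' W' ∈ A := fun V' hlt W' hV' hW' hL' =>
    ihV V' ⟨W', hL'⟩ hlt W' hV' hW' hL'
  refine (wellFoundedOn_dlexLT L).induction (P := fun W => W ≠ [] →
    (V ++ W).Perm L → wordPairing a B V W ∈ A) ⟨V, List.perm_append_comm.trans hL⟩ ?_ hW hL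
  clear! W
  intro W _ ihW hW hL
  have hlen : V.length + W.length = N := by rw [← hLN, ← hL.length_eq, List.length_append]
  by_cases hVlyn : IsLyndon V
  swap
  -- Moving `U` to the right leaves the shorter word `P` on the left. The other shuffles of `P` and
  -- `U` are smaller than `V`, so the outer induction covers both.
  · obtain ⟨P, U, hP, hU, hmax⟩ := exists_isMaxShuffle_of_not_isLyndon hV hVlyn
    have hperm := perm_of_mem_wordShuffles hmax.1
    have hVlen := length_of_mem_wordShuffles hmax.1
    have hUl := List.length_pos_iff.2 hU
    refine wordPairing_mem_of_isMaxShuffle a B (Subalgebra.toSubmodule A) hmax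
      (hassoc P U W hP hU hW (by omega) fun Z hZ => ?_) fun Z hZ hlt => ?_
    · refine ihV P (List.Shortlex.of_length_lt (by omega)) Z hP ?_ ?_
      · have := length_of_mem_wordShuffles hZ
        exact List.length_pos_iff.1 (by omega)
      · refine (((perm_of_mem_wordShuffles hZ).append_left P).trans ?_).trans hL
        rw [← List.append_assoc]
        exact hperm.symm.append_right W
    · exact ihV Z (DlexLT.of_lt hZ.length_eq hlt) W
        (fun h => hV (by simpa [h] using hZ)) hW ((hZ.append_right W).trans hL)
  by_cases hVW : DlexLE V W
  swap
  · rw [hB.wordPairing_comm]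
    exact ihV W (dlexLT_of_not_dlexLE hVW) V hW hV (List.perm_append_comm.trans hL)
  by_cases hgen : ∃ W₁ W₂ : List I, W₁ ≠ [] ∧ W₂ ≠ [] ∧ DlexLT W₁ V ∧ IsMaxShuffle W W₁ W₂
  -- Here `W₂` is moved over to `V`: the first word `W₁` is below `V`, so the outer induction
  -- applies. The shuffles smaller than `W` keep `V` and use the inner induction.
  · obtain ⟨W₁, W₂, h₁, h₂, hlt, hmax⟩ := hgen
    have hperm := perm_of_mem_wordShuffles hmax.1
    have hWlen := length_of_mem_wordShuffles hmax.1
    have hVl := List.length_pos_iff.2 hV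
    rw [hB.wordPairing_comm]
    refine wordPairing_mem_of_isMaxShuffle a B (Subalgebra.toSubmodule A) hmax
      (hassoc W₁ W₂ V h₁ h₂ hV (by omega) fun Z hZ => ?_) fun Z hZ hlt' => ?_
    · refine ihV W₁ hlt Z h₁ ?_ ?_
      · have := length_of_mem_wordShuffles hZ
        exact List.length_pos_iff.1 (by omega)
      · refine (((perm_of_mem_wordShuffles hZ).append_left W₁).trans ?_).trans hL
        rw [← List.append_assoc]
        exact (hperm.symm.append_right V).trans List.perm_append_comm
    · rw [hB.wordPairing_comm]
      have hLZ : (V ++ Z).Perm L := (hZ.append_left V).trans hL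
      exact ihW Z ⟨V, List.perm_append_comm.trans hLZ⟩ (DlexLT.of_lt hZ.length_eq hlt')
        (fun h => hW (by simpa [h] using hZ)) hLZ
  · exact hA (V, W) ⟨hV, hW, hVW, hVlyn, hgen⟩

end IsShufflePairing

end ShufflePairing

/-! ### From pairs of words to arbitrary tensors -/

section Generation

variable (C : Type*) [CommRing C] {M : Type*} [AddCommGroup M] [Module C M]
variable {I : Type*} (a : I → M)

/-- The letters generate the tensor algebra as an algebra, and the monomials in them are the word
tensors. -/
theorem span_range_wordTensor (ha : Submodule.span C (Set.range a) = ⊤) :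
    Submodule.span C (Set.range (wordTensor C a)) = ⊤ := by
  have hadj : Algebra.adjoin C (Set.range fun i => TensorAlgebra.ι C (a i)) = ⊤ := by
    rw [← TensorAlgebra.adjoin_range_ι, ← Algebra.adjoin_span]
    congr 1
    have : (Set.range fun i => TensorAlgebra.ι C (a i)) = TensorAlgebra.ι C '' Set.range a := by
      rw [← Set.range_comp]; rfl
    rw [this, Submodule.span_image, ha, Submodule.map_top, LinearMap.coe_range]
  rw [eq_top_iff, ← Algebra.top_toSubmodule, ← hadj, Algebra.adjoin_eq_span]
  refine Submodule.span_mono fun x hx => ?_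
  obtain ⟨L, hL, rfl⟩ := Submonoid.exists_list_of_mem_closure hx
  clear hx
  induction L with
  | nil => exact ⟨[], rfl⟩
  | cons y L ih =>
    obtain ⟨V, hV⟩ := ih fun z hz => hL z (List.mem_cons_of_mem y hz)
    obtain ⟨i, rfl⟩ := hL y List.mem_cons_self
    exact ⟨i :: V, by rw [List.prod_cons, ← hV]; simp [wordTensor, pureTensor]⟩

theorem pairing_mem_of_wordPairing_mem {E : Type*} [AddCommGroup E] [Module C E]
    (B : TensorAlgebra C M →ₗ[C] TensorAlgebra C M →ₗ[C] E)
    (ha : Submodule.span C (Set.range a) = ⊤) (A : Submodule C E)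
    (hA : ∀ V W : List I, B (wordTensor C a V) (wordTensor C a W) ∈ A)
    (f g : TensorAlgebra C M) : B f g ∈ A := by
  have hspan := span_range_wordTensor C a ha
  have hf : f ∈ Submodule.span C (Set.range (wordTensor C a)) := hspan ▸ Submodule.mem_top
  have hg : g ∈ Submodule.span C (Set.range (wordTensor C a)) := hspan ▸ Submodule.mem_top
  induction hf using Submodule.span_induction with
  | zero => rw [map_zero, LinearMap.zero_apply]; exact A.zero_mem
  | add x y _ _ hx hy => rw [map_add, LinearMap.add_apply]; exact A.add_mem hx hy
  | smul c x _ hx => rw [map_smul, LinearMap.smul_apply]; exact A.smul_mem c hx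
  | mem x hx =>
    obtain ⟨V, rfl⟩ := hx
    induction hg using Submodule.span_induction with
    | zero => rw [map_zero]; exact A.zero_mem
    | add x y _ _ hx hy => rw [map_add]; exact A.add_mem hx hy
    | smul c x _ hx => rw [map_smul]; exact A.smul_mem c hx
    | mem x hx =>
      obtain ⟨W, rfl⟩ := hx
      exact hA V W

theorem IsShufflePairing.mem_of_generatorPairs [LinearOrder I] [Algebra ℚ C]
    {E : Type*} [CommRing E] [Algebra C E]
    {B : TensorAlgebra C M →ₗ[C] TensorAlgebra C M →ₗ[C] E} (hB : IsShufflePairing B)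
    (hone : ∀ g, B 1 g = 0) {a : I → M} (ha : Submodule.span C (Set.range a) = ⊤)
    (A : Subalgebra C E) (hA : ∀ p ∈ generatorPairs I, wordPairing a B p.1 p.2 ∈ A)
    (f g : TensorAlgebra C M) : B f g ∈ A := by
  refine pairing_mem_of_wordPairing_mem C a B ha (Subalgebra.toSubmodule A) (fun V W => ?_) f g
  by_cases hV : V = []
  · subst hV
    exact (hone _).symm ▸ A.zero_mem
  by_cases hW : W = []
  · subst hW
    exact ((hB.comm _ _).trans (hone _)).symm ▸ A.zero_mem
  exact hB.wordPairing_mem_of_generatorPairs A hA V W hV hW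

end Generation

/-! ### The pairing with values in the algebra of evaluation constants -/

section EvalPairing

variable (C : Type*) [CommRing C]

/-- The symmetric product as a bilinear map. -/
def symmProdHom (X : Type*) [AddCommGroup X] [Module C X] : X →ₗ[C] X →ₗ[C] SymmSquare C X :=
  (TensorProduct.mk C X X).compr₂ (symmRelations C X).mkQ

/-- The linear map from a module to a quotient of its symmetric algebra. -/
def toSymmetricQuotient (X : Type*) [AddCommGroup X] [Module C X]
    (J : Ideal (SymmetricAlgebra C X)) : X →ₗ[C] SymmetricAlgebra C X ⧸ J :=
  (Ideal.Quotient.mkₐ C J).toLinearMap ∘ₗ SymmetricAlgebra.ι C X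

variable (M : Type*) [AddCommGroup M] [Module C M]

/-- The bilinear map sending `f` and `g` to the class of `ε(f ⊙ g)`. -/
def evalPairing :
    TensorAlgebra C M →ₗ[C] TensorAlgebra C M →ₗ[C] EvalConstants C M :=
  ((symmProdHom C (positivePart C M)).compr₂
    (toSymmetricQuotient C (ModuleM2 C M) (constIdeal C M))).compl₁₂
    (positiveProj C M) (positiveProj C M)

variable {M}

theorem evalPairing_apply (f g : TensorAlgebra C M) :
    evalPairing C M f g = Ideal.Quotient.mk (constIdeal C M) (eps C f g) := rfl

theorem evalPairing_comm (f g : TensorAlgebra C M) :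
    evalPairing C M f g = evalPairing C M g f := by
  have h : symmProd C (positiveProj C M f) (positiveProj C M g) =
      symmProd C (positiveProj C M g) (positiveProj C M f) :=
    (Submodule.Quotient.eq _).2 (Submodule.subset_span ⟨_, _, rfl⟩)
  rw [evalPairing_apply, evalPairing_apply, eps, eps, h]

theorem isShufflePairing_evalPairing : IsShufflePairing (evalPairing C M) where
  comm := evalPairing_comm C
  rel f g h hf hg hh := by
    have hrel : Ideal.Quotient.mk (constIdeal C M) (constRel C f g h) = 0 :=
      Ideal.Quotient.eq_zero_iff_mem.2 (Ideal.subset_span ⟨f, g, h, hf, hg, hh, rfl⟩)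
    simp only [constRel, map_add, map_sub, map_sum, map_mul] at hrel
    simp only [evalPairing_apply]
    exact hrel

theorem wordPairing_evalPairing {I : Type*} (a : I → M) (V W : List I) :
    wordPairing a (evalPairing C M) V W = wordConst C a V W := rfl

theorem evalPairing_one_left (g : TensorAlgebra C M) : evalPairing C M 1 g = 0 := by
  have h : positiveProj C M 1 = 0 := by
    apply Subtype.ext
    simp [positiveProj]
  have h' : symmProdHom C (positivePart C M) (positiveProj C M 1) (positiveProj C M g) = 0 := by
    rw [h, LinearMap.map_zero₂]
  exact (congrArg (toSymmetricQuotient C (ModuleM2 C M) (constIdeal C M)) h').trans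
    (LinearMap.map_zero _)

/-- The values of the pairing include the classes of all `ε(f ⊙ g)`. These span the image of
`ε(M₂)`, which generates the quotient of the symmetric algebra. -/
theorem subalgebra_eq_top_of_evalPairing_mem (A : Subalgebra C (EvalConstants C M))
    (hA : ∀ f g : TensorAlgebra C M, evalPairing C M f g ∈ A) : A = ⊤ := by
  have hι : ∀ m, toSymmetricQuotient C (ModuleM2 C M) (constIdeal C M) m ∈ A := by
    intro m
    obtain ⟨t, rfl⟩ := Submodule.mkQ_surjective _ m
    induction t using TensorProduct.induction_on with
    | zero => rw [LinearMap.map_zero, LinearMap.map_zero]; exact A.zero_mem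
    | add y z hy hz => rw [LinearMap.map_add, LinearMap.map_add]; exact A.add_mem hy hz
    | tmul f g =>
      have h := hA f g
      rw [evalPairing_apply, eps, positiveProj_of_mem C f.2, positiveProj_of_mem C g.2] at h
      exact h
  rw [eq_top_iff]
  rintro x -
  obtain ⟨y, rfl⟩ := Ideal.Quotient.mk_surjective x
  induction y using SymmetricAlgebra.induction with
  | algebraMap r => exact A.algebraMap_mem r
  | mul y z hy hz => rw [map_mul]; exact A.mul_mem hy hz
  | add y z hy hz => rw [map_add]; exact A.add_mem hy hz
  | ι m => exact hι m

theorem eq_top_of_wordConst_mem [Algebra ℚ C] {I : Type*} [LinearOrder I] (a : I → M)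
    (ha : Submodule.span C (Set.range a) = ⊤) (A : Subalgebra C (EvalConstants C M))
    (hA : ∀ p ∈ generatorPairs I, wordConst C a p.1 p.2 ∈ A) : A = ⊤ := by
  have hA' : ∀ p ∈ generatorPairs I, wordPairing a (evalPairing C M) p.1 p.2 ∈ A :=
    fun p hp => by rw [wordPairing_evalPairing]; exact hA p hp
  exact subalgebra_eq_top_of_evalPairing_mem C A
    ((isShufflePairing_evalPairing C).mem_of_generatorPairs C (evalPairing_one_left C) ha A hA')

end EvalPairing

end FreeIDR

end

theorem mainTheorem6 {R : Type*} [CommRing R] [Differential R]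
    [Algebra ℚ (FreeIDR.constants R)]
    (Q : R →ₗ[FreeIDR.constants R] R) (hQ : FreeIDR.IsQuasiIntegration Q)
    {I : Type*} [LinearOrder I] (a : I → FreeIDR.nonIntegrable Q)
    (ha : Submodule.span (FreeIDR.constants R) (Set.range a) = ⊤) :
    Algebra.adjoin (FreeIDR.constants R)
      {c : FreeIDR.EvalConstants (FreeIDR.constants R) (FreeIDR.nonIntegrable Q) |
        ∃ p ∈ FreeIDR.generatorPairs I,
          c = FreeIDR.wordConst (FreeIDR.constants R) a p.1 p.2} = ⊤ :=
  FreeIDR.eq_top_of_wordConst_mem _ a ha _ fun p hp =>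
    Algebra.subset_adjoin ⟨p, hp, rfl⟩
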